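/- **Theorem (discrete Toda $\tau$-function).** *Notation.* For arrays $f=(f_n^t)_{n,t\in\mathbb Z}$ write $\nabla_{(n)}(f)_n^t=f_n^t-f_{n-1}^t$ and $\nabla_{(t)}(f)_n^t=f_n^{t+1}-f_n^t$; $\nabla_{(n)}(x)_n=x_n-x_{n-1}$ for sequences. Sums use the signed convention $\sum_{m=a}^{b}:=0$ if $a=b+1$ and $\sum_{m=a}^{b}:=-\sum_{m=b+1}^{a-1}$ if $a>b+1$. Let $\mathcal S^{lin}$ be the set of $S:\mathbb Z\to\mathbb R$ for which $\lim_{n\to+\infty}S_n/n$ and $\lim_{n\to-\infty}S_n/n$ exist in $(0,\infty)$ (possibly different). For $S\in\mathcal S^{lin}$ let $M^{\Sigma^*}(S)_n=\log\big(\sum_{m\le (n-1)/2}e^{S_{2m}}\big)$ for $n$ odd, $M^{\Sigma^*}(S)_n=\tfrac12\big(M^{\Sigma^*}(S)_{n+1}+M^{\Sigma^*}(S)_{n-1}\big)$ for $n$ even, $T^{\Sigma^*}(S)=2M^{\Sigma^*}(S)-S$, and $\mathcal T^{\Sigma^*}=\theta\circ T^{\Sigma^*}$ with the left shift $\theta(S)_n=S_{n+1}$.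 The sums converge and $\mathcal T^{\Sigma^*}$ is a bijection of $\mathcal S^{lin}$, so that $(\mathcal T^{\Sigma^*})^t$ is defined on $\mathcal S^{lin}$ for all $t\in\mathbb Z$. For positive sequences $I,J$ the path encoding $S_{dT}(I,J)$ is the path with $S_0=0$, $S_n-S_{n-1}=\log I_{(n+1)/2}$ for $n$ odd, $S_n-S_{n-1}=-\log J_{n/2}$ for $n$ even. Let $\mathcal C_{dT}$ be the set of pairs of positive sequences $(I,J)$ for which, with $D_n=\sum_{m=1}^n(\log J_m-\log I_m)$, $$\lim_{n\to\infty}\frac{D_n}{n}=\lim_{n\to\infty}\frac{D_n-\log I_{n+1}}{n}<0,\qquad \lim_{n\to-\infty}\frac{D_n}{n}=\lim_{n\to-\infty}\frac{D_n-\log J_n}{n}<0.$$ The discrete Toda equation (dToda), for variables $(I_n^t,J_n^t,U_n^t)_{n,t\in\mathbb Z}$ in $(0,\infty)$, is: for all $n,t\in\mathbb Z$, $$I_n^{t+1}=J_n^t+U_n^t,\qquad J_n^{t+1}=I_{n+1}^tJ_n^t(I_n^{t+1})^{-1},\qquad U_{n+1}^t=I_{n+1}^tU_n^t(I_n^{t+1})^{-1}.$$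 *Statement.* Let $x,y\in\mathbb R^{\mathbb Z}$ be such that $$\lim_{n\to\infty}\frac{2y_n-\nabla_{(n)}(x)_{n+1}}{n}=\lim_{n\to\infty}\frac{y_n+y_{n-1}-\nabla_{(n)}(x)_n}{n}>0,$$ $$\lim_{n\to-\infty}\frac{2y_n-\nabla_{(n)}(x)_{n+1}}{n}=\lim_{n\to-\infty}\frac{y_n+y_{n-1}-\nabla_{(n)}(x)_n}{n}>0,$$ where the limits are assumed to exist in $\mathbb R$. Then there is a unique array $\tau=(\tau_n^t)_{n,t\in\mathbb Z}$ of positive reals with $$\tau_n^{t+1}\tau_n^{t-1}=(\tau_n^t)^2+\tau_{n+1}^{t-1}\tau_{n-1}^{t+1}\quad\text{for all }n,t\in\mathbb Z,\qquad \log(\tau^0)=x,\qquad \nabla_{(t)}(\log\tau)^0=y.$$ Define $(I,J)$ by $\log I_n=\nabla_{(n)}(y)_n$ and $\log J_n=-\nabla_{(n)}(y)_n+\nabla_{(n)}(x)_{n+1}-\nabla_{(n)}(x)_n$; then $(I,J)\in\mathcal C_{dT}$. Let $S^0=S_{dT}(I,J)+2y_0-\nabla_{(n)}(x)_1$ (a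 constant shift of the path encoding) and $S^t=(\mathcal T^{\Sigma^*})^t(S^0)\in\mathcal S^{lin}$ for $t\in\mathbb Z$, and let $(A_n^t)_{n,t\in\mathbb Z}$ be the array uniquely determined by $$A_0^0=y_0,\qquad A_0^{t+1}-A_0^t=\frac{S_1^t+S_0^{t+1}-2S_0^t}{2},\qquad A_{n+1}^t-A_n^t=S_{2n+1}^t-S_{2n}^t\qquad(n,t\in\mathbb Z).$$ Then, for all $n,t\in\mathbb Z$, $$\log\tau_n^t=x_0+\sum_{s=0}^{t+n-1}A_0^s-\sum_{m=1}^n\left(S_{2(n-m)}^{t+m-1}-A_{n-m}^{t+m-1}\right).$$ Moreover, the array $(I_n^t,J_n^t,U_n^t)_{n,t\in\mathbb Z}$ given by $$\log I_n^t=\nabla_{(n)}\nabla_{(t)}(\log\tau)_n^t,\qquad \log J_n^t=-\nabla_{(n)}\nabla_{(t)}(\log\tau)_n^t+\nabla_{(n)}\nabla_{(n)}(\log\tau)_{n+1}^t,$$ $$\log U_n^t=-\nabla_{(t)}\nabla_{(t)}(\log\tau)_{n-1}^t+\nabla_{(n)}\nabla_{(t)}(\log\tau)_n^t$$ is the unique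 solution of (dToda) with $(I^0,J^0)=(I,J)$. It satisfies $(I^t,J^t)\in\mathcal C_{dT}$ for all $t$, and with $\bar S^t=(\mathcal T^{\Sigma^*})^t(S_{dT}(I,J))$ it is given by $$I_n^t=e^{\bar S^t_{2n-1}-\bar S^t_{2n-2}},\qquad J_n^t=e^{-(\bar S^t_{2n}-\bar S^t_{2n-1})},\qquad U_n^t=e^{(\bar S^t_{2n-1}-\bar S^{t+1}_{2n-2})/2}.$$ -/

import Mathlib

open Filter Topology

noncomputable section

namespace DToda

/-- The sum `∑_{m=a}^{b} f m` with the signed convention: it is `0` if `a = b + 1`, and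
`-∑_{m=b+1}^{a-1} f m` if `a > b + 1`. (For every `a`, `b` at most one of the two finite sums
below is non-empty.) -/
def signedSum (f : ℤ → ℝ) (a b : ℤ) : ℝ :=
  ∑ m ∈ Finset.Icc a b, f m - ∑ m ∈ Finset.Icc (b + 1) (a - 1), f m

theorem signedSum_self (f : ℤ → ℝ) (b : ℤ) : signedSum f (b + 1) b = 0 := by
  simp [signedSum]

theorem signedSum_succ (f : ℤ → ℝ) (a b : ℤ) :
    signedSum f a (b + 1) = signedSum f a b + f (b + 1) := by
  unfold signedSum
  rcases le_or_gt a (b + 1) with h | h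
  · have h1 : Finset.Icc a (b + 1) = insert (b + 1) (Finset.Icc a b) := by
      ext m; simp only [Finset.mem_Icc, Finset.mem_insert]; omega
    have h2 : Finset.Icc (b + 1) (a - 1) = ∅ := Finset.Icc_eq_empty (by omega)
    have h3 : Finset.Icc (b + 1 + 1) (a - 1) = ∅ := Finset.Icc_eq_empty (by omega)
    rw [h1, h2, h3, Finset.sum_insert (by simp)]
    simp only [Finset.sum_empty]
    ring
  · have h1 : Finset.Icc (b + 1) (a - 1) = insert (b + 1) (Finset.Icc (b + 1 + 1) (a - 1)) := by
      ext m; simp only [Finset.mem_Icc, Finset.mem_insert]; omega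
    have h2 : Finset.Icc a b = ∅ := Finset.Icc_eq_empty (by omega)
    have h3 : Finset.Icc a (b + 1) = ∅ := Finset.Icc_eq_empty (by omega)
    rw [h1, h2, h3, Finset.sum_insert (by simp)]
    simp only [Finset.sum_empty]
    ring

/-! ### Difference operators. Arrays `f` are written `f t n` for `f_n^t` (time first). -/

/-- `∇_(n)` on sequences. -/
def gradSeq (x : ℤ → ℝ) (n : ℤ) : ℝ := x n - x (n - 1)

/-- `∇_(n)` on arrays. -/
def gradN (f : ℤ → ℤ → ℝ) (t n : ℤ) : ℝ := f t n - f t (n - 1)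

/-- `∇_(t)` on arrays. -/
def gradT (f : ℤ → ℤ → ℝ) (t n : ℤ) : ℝ := f (t + 1) n - f t n

/-- The entrywise logarithm of an array. -/
def logArray (f : ℤ → ℤ → ℝ) (t n : ℤ) : ℝ := Real.log (f t n)

/-! ### Paths and the Pitman-type transformation -/

/-- The asymptotically linear paths: `S_n / n` has positive limits at `+∞` and at `-∞`
(the two limits may differ). -/
def Slin : Set (ℤ → ℝ) :=
  {S | (∃ c : ℝ, 0 < c ∧ Tendsto (fun n : ℤ => S n / (n : ℝ)) atTop (𝓝 c)) ∧
    (∃ c : ℝ, 0 < c ∧ Tendsto (fun n : ℤ => S n / (n : ℝ)) atBot (𝓝 c))}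

/-- `log ∑_{m ≤ k} exp (S_{2m})`, the sum over all integers `m ≤ k` being enumerated as
`m = k - j` with `j = 0, 1, 2, …`. -/
def logSumExp (S : ℤ → ℝ) (k : ℤ) : ℝ :=
  Real.log (∑' j : ℕ, Real.exp (S (2 * (k - (j : ℤ)))))

/-- The functional `M^{∑*}`. -/
def pastMax (S : ℤ → ℝ) (n : ℤ) : ℝ :=
  if Odd n then logSumExp S ((n - 1) / 2)
  else (logSumExp S ((n + 1 - 1) / 2) + logSumExp S ((n - 1 - 1) / 2)) / 2

/-- The transformation `T^{∑*}(S) = 2 M^{∑*}(S) - S`. -/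
def pitman (S : ℤ → ℝ) (n : ℤ) : ℝ := 2 * pastMax S n - S n

/-- The left shift. -/
def shift (S : ℤ → ℝ) (n : ℤ) : ℝ := S (n + 1)

/-- One step of the path dynamics, `θ ∘ T^{∑*}`. -/
def step (S : ℤ → ℝ) : ℤ → ℝ := shift (pitman S)

/-- The iterates `(θ ∘ T^{∑*})^t`, `t ∈ ℤ`; negative powers are powers of the inverse of
`θ ∘ T^{∑*}` on `Slin`. -/
def iter : ℤ → (ℤ → ℝ) → (ℤ → ℝ)
  | Int.ofNat k => step^[k]
  | Int.negSucc k => (Function.invFunOn step Slin)^[k + 1]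

/-! ### The discrete Toda equation -/

/-- `(I, J, U)` takes values in `(0, ∞)` and solves the discrete Toda equation. -/
structure IsTodaSolution (I J U : ℤ → ℤ → ℝ) : Prop where
  posI : ∀ t n, 0 < I t n
  posJ : ∀ t n, 0 < J t n
  posU : ∀ t n, 0 < U t n
  eqI : ∀ t n, I (t + 1) n = J t n + U t n
  eqJ : ∀ t n, J (t + 1) n = I t (n + 1) * J t n * (I (t + 1) n)⁻¹
  eqU : ∀ t n, U t (n + 1) = I t (n + 1) * U t n * (I (t + 1) n)⁻¹

/-- The class `C_{dT}` of initial configurations. -/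
def Cdt : Set ((ℤ → ℝ) × (ℤ → ℝ)) :=
  {p | (∀ n, 0 < p.1 n) ∧ (∀ n, 0 < p.2 n) ∧
    (∃ c : ℝ, c < 0 ∧
      Tendsto (fun n : ℤ => signedSum (fun m => Real.log (p.2 m) - Real.log (p.1 m)) 1 n / (n : ℝ))
        atTop (𝓝 c) ∧
      Tendsto (fun n : ℤ => (signedSum (fun m => Real.log (p.2 m) - Real.log (p.1 m)) 1 n
        - Real.log (p.1 (n + 1))) / (n : ℝ)) atTop (𝓝 c)) ∧
    (∃ c : ℝ, c < 0 ∧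
      Tendsto (fun n : ℤ => signedSum (fun m => Real.log (p.2 m) - Real.log (p.1 m)) 1 n / (n : ℝ))
        atBot (𝓝 c) ∧
      Tendsto (fun n : ℤ => (signedSum (fun m => Real.log (p.2 m) - Real.log (p.1 m)) 1 n
        - Real.log (p.2 n)) / (n : ℝ)) atBot (𝓝 c))}

/-- The increments of the path encoding of `(I, J)`. -/
def pathIncr (I J : ℤ → ℝ) (n : ℤ) : ℝ :=
  if Odd n then Real.log (I ((n + 1) / 2)) else -Real.log (J (n / 2))

/-- The path encoding `S_{dT}(I, J)`: the path with `S_0 = 0` and the increments above. -/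
def pathEncoding (I J : ℤ → ℝ) (n : ℤ) : ℝ := signedSum (pathIncr I J) 1 n

theorem pathEncoding_zero (I J : ℤ → ℝ) : pathEncoding I J 0 = 0 :=
  signedSum_self _ 0

theorem pathEncoding_sub (I J : ℤ → ℝ) (n : ℤ) :
    pathEncoding I J n - pathEncoding I J (n - 1) = pathIncr I J n := by
  have h := signedSum_succ (pathIncr I J) 1 (n - 1)
  rw [sub_add_cancel] at h
  unfold pathEncoding
  rw [h]
  ring

/-! ### The `τ`-function equation -/

/-- `τ` is positive and solves the `τ`-function version of the discrete Toda equation. -/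
structure IsTauSolution (τ : ℤ → ℤ → ℝ) : Prop where
  pos : ∀ t n, 0 < τ t n
  eq : ∀ t n, τ (t + 1) n * τ (t - 1) n = τ t n ^ 2 + τ (t - 1) (n + 1) * τ (t + 1) (n - 1)

/-- `τ` is a (positive) solution with `log τ^0 = x` and `∇_(t)(log τ)^0 = y`. -/
def SolvesTauIVP (x y : ℤ → ℝ) (τ : ℤ → ℤ → ℝ) : Prop :=
  IsTauSolution τ ∧ (∀ n, Real.log (τ 0 n) = x n) ∧ (∀ n, gradT (logArray τ) 0 n = y n)

/-- The growth condition on the initial data `(x, y)`. -/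
def GrowthCondition (x y : ℤ → ℝ) : Prop :=
  (∃ c : ℝ, 0 < c ∧
    Tendsto (fun n : ℤ => (2 * y n - gradSeq x (n + 1)) / (n : ℝ)) atTop (𝓝 c) ∧
    Tendsto (fun n : ℤ => (y n + y (n - 1) - gradSeq x n) / (n : ℝ)) atTop (𝓝 c)) ∧
  (∃ c : ℝ, 0 < c ∧
    Tendsto (fun n : ℤ => (2 * y n - gradSeq x (n + 1)) / (n : ℝ)) atBot (𝓝 c) ∧
    Tendsto (fun n : ℤ => (y n + y (n - 1) - gradSeq x n) / (n : ℝ)) atBot (𝓝 c))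

/-- The initial configuration `log I_n = ∇_(n)(y)_n`. -/
def initI (y : ℤ → ℝ) (n : ℤ) : ℝ := Real.exp (gradSeq y n)

/-- The initial configuration `log J_n = -∇_(n)(y)_n + ∇_(n)(x)_{n+1} - ∇_(n)(x)_n`. -/
def initJ (x y : ℤ → ℝ) (n : ℤ) : ℝ :=
  Real.exp (-gradSeq y n + gradSeq x (n + 1) - gradSeq x n)

/-- The initial path: the path encoding of the initial configuration, started from the height
`2 y_0 - ∇_(n)(x)_1` instead of `0`. -/
def initPath (x y : ℤ → ℝ) (n : ℤ) : ℝ :=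
  (2 * y 0 - gradSeq x 1) + pathEncoding (initI y) (initJ x y) n

/-- The equations that determine the array `A` from the paths `S` and from `y_0`. -/
structure IsAuxArray (y₀ : ℝ) (S : ℤ → ℤ → ℝ) (A : ℤ → ℤ → ℝ) : Prop where
  zero : A 0 0 = y₀
  time : ∀ t, A (t + 1) 0 - A t 0 = (S t 1 + S (t + 1) 0 - 2 * S t 0) / 2
  space : ∀ t n, A t (n + 1) - A t n = S t (2 * n + 1) - S t (2 * n)

/-- `I_n^t` in terms of `τ`. -/
def tauI (τ : ℤ → ℤ → ℝ) (t n : ℤ) : ℝ :=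
  Real.exp (gradN (gradT (logArray τ)) t n)

/-- `J_n^t` in terms of `τ`. -/
def tauJ (τ : ℤ → ℤ → ℝ) (t n : ℤ) : ℝ :=
  Real.exp (-gradN (gradT (logArray τ)) t n + gradN (gradN (logArray τ)) t (n + 1))

/-- `U_n^t` in terms of `τ`. -/
def tauU (τ : ℤ → ℤ → ℝ) (t n : ℤ) : ℝ :=
  Real.exp (-gradT (gradT (logArray τ)) t (n - 1) + gradN (gradT (logArray τ)) t n)

end DToda

end

open DToda

/-!
The dynamics lives on paths. For an asymptotically linear path `S` put
`E_k = ∑_{m ≤ k} exp (S_{2m})`. Then `E_k - E_{k-1} = exp (S_{2k})`, and `S' = step S` is given by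
`exp S'_{2k} = E_k² / exp S_{2k+1}` and `exp (-S'_{2k+1}) = 1 / E_k - 1 / E_{k+1}`.
Comparison with geometric series shows that `log E_k` grows like `S_{2k}` at both ends, so `step`
preserves `Slin` (`step_mem_Slin`). Since `E_k → ∞`, the last formula telescopes to
`∑_{k ≥ m} exp (-S'_{2k+1}) = 1 / E_m`; this says that the reflection `S_n ↦ -S_{1-n}` conjugates
`step` to its inverse (`Slin.step_reflect_step`), and `step` is a bijection of `Slin`
(`bijOn_step`).

Positive solutions of the discrete Toda equation and of the `τ`-function equation both give rise to
a *flow* (`IsFlow`): paths `S^t` obeying the formulas above with a positive sequence `F^t` in place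
of `E(S^t)`, subject only to `F_k - F_{k-1} = exp (S_{2k})`. For the Toda equation
`F_k = exp (S_{2k+1}) / U_{k+1}` (`IsTodaSolution.isFlow`), for the `τ`-function equation
`F_k = τ_k^{t+2} / τ_{k+1}^t` (`IsTauSolution.isFlow`).

Uniqueness is a statement about flows. If `S^t` lies in `Slin`, then `F^t - E(S^t)` is a constant,
and positivity of `F^t` and of `F^{t+1}` forces it to vanish (`IsFlow.eq_expSum`). Hence
`S^{t+1} = step S^t`. Reflected and run backwards, a flow is again a flow (`IsFlow.reflect`), so a
flow that starts in `Slin` is the orbit of its initial path for all times of either sign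
(`IsFlow.eq_iter`). The growth condition on `(x, y)` is membership of the initial path in `Slin`.

For existence, the array `A` is built from the orbit, and `log τ` is its sum in time with initial
value `x`. Induction in time in both directions gives
`S^t_{2n} = 2 A_n^t - log τ_{n+1}^t + log τ_n^t`, and `E_n - E_{n-1} = exp (S_{2n})` becomes the
`τ`-function equation (`exists_solvesTauIVP`). As `A = ∇_(t) log τ`, both sums in the explicit
formula telescope (`SolvesTauIVP.log_eq`).
-/

namespace DToda

/-! ### Linear growth along `ℤ` -/

theorem tendsto_intCast_inv_atTop : Tendsto (fun n : ℤ => ((n : ℝ))⁻¹) atTop (𝓝 0) :=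
  tendsto_inv_atTop_zero.comp tendsto_intCast_atTop_atTop

theorem tendsto_intCast_inv_atBot : Tendsto (fun n : ℤ => ((n : ℝ))⁻¹) atBot (𝓝 0) :=
  tendsto_inv_atBot_zero.comp (tendsto_intCast_atBot_iff.2 tendsto_id)

theorem tendsto_two_mul_add_atTop (r : ℤ) : Tendsto (fun k : ℤ => 2 * k + r) atTop atTop :=
  tendsto_atTop.2 fun b => (eventually_ge_atTop (|b| + |r|)).mono fun k hk => by
    have := abs_nonneg b; have := abs_nonneg r; have := le_abs_self b; have := neg_abs_le r; omega

theorem tendsto_two_mul_add_atBot (r : ℤ) : Tendsto (fun k : ℤ => 2 * k + r) atBot atBot :=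
  tendsto_atBot.2 fun b => (eventually_le_atBot (-|b| - |r|)).mono fun k hk => by
    have := abs_nonneg b; have := abs_nonneg r; have := neg_abs_le b; have := le_abs_self r; omega

theorem tendsto_atTop_of_parity {X : Type*} {f : ℤ → X} {l : Filter X}
    (h0 : Tendsto (fun k => f (2 * k)) atTop l) (h1 : Tendsto (fun k => f (2 * k - 1)) atTop l) :
    Tendsto f atTop l := fun s hs => by
  obtain ⟨a, ha⟩ := eventually_atTop.1 (h0.eventually hs)
  obtain ⟨b, hb⟩ := eventually_atTop.1 (h1.eventually hs)
  refine eventually_atTop.2 ⟨2 * max a b, fun n hn => ?_⟩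
  obtain ⟨k, rfl | rfl⟩ : ∃ k, n = 2 * k ∨ n = 2 * k - 1 := ⟨(n + 1) / 2, by omega⟩
  · exact ha k (by omega)
  · exact hb k (by omega)

theorem tendsto_atBot_of_parity {X : Type*} {f : ℤ → X} {l : Filter X}
    (h0 : Tendsto (fun k => f (2 * k)) atBot l) (h1 : Tendsto (fun k => f (2 * k - 1)) atBot l) :
    Tendsto f atBot l := fun s hs => by
  obtain ⟨a, ha⟩ := eventually_atBot.1 (h0.eventually hs)
  obtain ⟨b, hb⟩ := eventually_atBot.1 (h1.eventually hs)
  refine eventually_atBot.2 ⟨2 * min a b - 2, fun n hn => ?_⟩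
  obtain ⟨k, rfl | rfl⟩ : ∃ k, n = 2 * k ∨ n = 2 * k - 1 := ⟨(n + 1) / 2, by omega⟩
  · exact ha k (by omega)
  · exact hb k (by omega)

theorem tendsto_two_mul_add_div {l : Filter ℤ} (hl : Tendsto (fun n : ℤ => ((n : ℝ))⁻¹) l (𝓝 0))
    (h0 : ∀ᶠ n in l, n ≠ 0) (r : ℤ) :
    Tendsto (fun k : ℤ => ((2 * k + r : ℤ) : ℝ) / (k : ℝ)) l (𝓝 2) := by
  have h := (hl.const_mul (r : ℝ)).const_add 2
  rw [mul_zero, add_zero] at h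
  refine h.congr' (h0.mono fun k hk => ?_)
  have : (k : ℝ) ≠ 0 := by exact_mod_cast hk
  push_cast
  field_simp

/-- If `f n / n → c`, then `f (2 k + r) / k → 2 c`; the filter is `atTop` or `atBot`. -/
theorem tendsto_div_two_mul_add {l : Filter ℤ} (hl : Tendsto (fun n : ℤ => ((n : ℝ))⁻¹) l (𝓝 0))
    (h0 : ∀ᶠ n in l, n ≠ 0) {r : ℤ} (hr : Tendsto (fun k : ℤ => 2 * k + r) l l) {f : ℤ → ℝ} {c : ℝ}
    (hf : Tendsto (fun n : ℤ => f n / (n : ℝ)) l (𝓝 c)) :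
    Tendsto (fun k : ℤ => f (2 * k + r) / (k : ℝ)) l (𝓝 (2 * c)) := by
  have h := (tendsto_two_mul_add_div hl h0 r).mul (hf.comp hr)
  refine h.congr' ((hr.eventually h0).mono fun k hk => ?_)
  have : ((2 * k + r : ℤ) : ℝ) ≠ 0 := by exact_mod_cast hk
  simp only [Function.comp]
  field_simp

theorem tendsto_two_mul_add_div_self {l : Filter ℤ}
    (hl : Tendsto (fun n : ℤ => ((n : ℝ))⁻¹) l (𝓝 0))
    (h0 : ∀ᶠ n in l, n ≠ 0) {r : ℤ} {f : ℤ → ℝ} {c : ℝ}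
    (hf : Tendsto (fun k : ℤ => f (2 * k + r) / (k : ℝ)) l (𝓝 c)) :
    Tendsto (fun k : ℤ => f (2 * k + r) / ((2 * k + r : ℤ) : ℝ)) l (𝓝 (c / 2)) := by
  refine (hf.div (tendsto_two_mul_add_div hl h0 r) two_ne_zero).congr' (h0.mono fun k hk => ?_)
  have : (k : ℝ) ≠ 0 := by exact_mod_cast hk
  simp only [Pi.div_apply]
  rcases eq_or_ne ((2 * k + r : ℤ) : ℝ) 0 with h | h
  · simp only [h, zero_div, div_zero]
  · field_simp

theorem eventually_ne_zero_atTop : ∀ᶠ n : ℤ in atTop, n ≠ 0 := eventually_ne_atTop 0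

theorem eventually_ne_zero_atBot : ∀ᶠ n : ℤ in atBot, n ≠ 0 := eventually_ne_atBot 0

theorem Slin.tendsto_atTop {S : ℤ → ℝ} {c : ℝ}
    (h : Tendsto (fun n : ℤ => S n / (n : ℝ)) atTop (𝓝 c)) (r : ℤ) :
    Tendsto (fun k : ℤ => S (2 * k + r) / (k : ℝ)) atTop (𝓝 (2 * c)) :=
  tendsto_div_two_mul_add tendsto_intCast_inv_atTop eventually_ne_zero_atTop
    (tendsto_two_mul_add_atTop r) h

theorem Slin.tendsto_atBot {S : ℤ → ℝ} {c : ℝ}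
    (h : Tendsto (fun n : ℤ => S n / (n : ℝ)) atBot (𝓝 c)) (r : ℤ) :
    Tendsto (fun k : ℤ => S (2 * k + r) / (k : ℝ)) atBot (𝓝 (2 * c)) :=
  tendsto_div_two_mul_add tendsto_intCast_inv_atBot eventually_ne_zero_atBot
    (tendsto_two_mul_add_atBot r) h

/-- A path is asymptotically linear as soon as its even and odd parts grow at the same positive
rate, at each of the two ends. -/
theorem Slin.of_parity {S : ℤ → ℝ}
    (h : ∃ c : ℝ, 0 < c ∧ Tendsto (fun k : ℤ => S (2 * k) / (k : ℝ)) atTop (𝓝 c) ∧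
      Tendsto (fun k : ℤ => S (2 * k - 1) / (k : ℝ)) atTop (𝓝 c))
    (h' : ∃ c : ℝ, 0 < c ∧ Tendsto (fun k : ℤ => S (2 * k) / (k : ℝ)) atBot (𝓝 c) ∧
      Tendsto (fun k : ℤ => S (2 * k - 1) / (k : ℝ)) atBot (𝓝 c)) : S ∈ Slin := by
  obtain ⟨c, hc, h0, h1⟩ := h
  obtain ⟨d, hd, k0, k1⟩ := h'
  refine ⟨⟨c / 2, half_pos hc, tendsto_atTop_of_parity ?_ ?_⟩,
    ⟨d / 2, half_pos hd, tendsto_atBot_of_parity ?_ ?_⟩⟩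
  · simpa using tendsto_two_mul_add_div_self (r := 0) (f := S)
      tendsto_intCast_inv_atTop eventually_ne_zero_atTop (by simpa using h0)
  · exact tendsto_two_mul_add_div_self (r := -1) (f := S)
      tendsto_intCast_inv_atTop eventually_ne_zero_atTop h1
  · simpa using tendsto_two_mul_add_div_self (r := 0) (f := S)
      tendsto_intCast_inv_atBot eventually_ne_zero_atBot (by simpa using k0)
  · exact tendsto_two_mul_add_div_self (r := -1) (f := S)
      tendsto_intCast_inv_atBot eventually_ne_zero_atBot k1

/-! ### The exponential functional `∑_{m ≤ k} exp (S_{2m})` -/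

/-- The sum `∑_{m ≤ k} exp (S_{2m})` whose logarithm is `logSumExp`. -/
noncomputable def expSum (S : ℤ → ℝ) (k : ℤ) : ℝ := ∑' j : ℕ, Real.exp (S (2 * (k - (j : ℤ))))

theorem Slin.summable {S : ℤ → ℝ} (hS : S ∈ Slin) (k : ℤ) :
    Summable fun j : ℕ => Real.exp (S (2 * (k - (j : ℤ)))) := by
  obtain ⟨-, c, hc, h⟩ := hS
  have h2 := Slin.tendsto_atBot h 0
  obtain ⟨a, ha⟩ := eventually_atBot.1 (h2.eventually (lt_mem_nhds (by linarith : c < 2 * c)))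
  have hg : Summable fun j : ℕ => Real.exp (k * c) * Real.exp (-c) ^ j :=
    (summable_geometric_of_lt_one (Real.exp_pos _).le (Real.exp_lt_one_iff.2 (by linarith))).mul_left _
  refine Summable.of_norm_bounded_eventually_nat hg ?_
  filter_upwards [eventually_ge_atTop (k - a).toNat, eventually_gt_atTop k.toNat] with j hj hj'
  have h3 := ha (k - j) (by omega)
  have hneg : ((k - j : ℤ) : ℝ) < 0 := by exact_mod_cast (by omega : k - (j : ℤ) < 0)
  rw [lt_div_iff_of_neg hneg, add_zero] at h3
  rw [Real.norm_eq_abs, abs_of_pos (Real.exp_pos _), ← Real.exp_nat_mul, ← Real.exp_add]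
  refine Real.exp_le_exp.2 ?_
  push_cast at h3
  linarith

variable {S : ℤ → ℝ}

theorem Slin.expSum_sub (hS : S ∈ Slin) (k : ℤ) :
    expSum S k - expSum S (k - 1) = Real.exp (S (2 * k)) := by
  have h := (Slin.summable hS k).tsum_eq_zero_add
  have h2 : (∑' j : ℕ, Real.exp (S (2 * (k - ((j + 1 : ℕ) : ℤ))))) = expSum S (k - 1) :=
    tsum_congr fun j => by congr 3; push_cast; ring
  rw [h2] at h
  unfold expSum at h ⊢
  rw [h]
  simp

theorem Slin.exp_le_expSum (hS : S ∈ Slin) (k : ℤ) : Real.exp (S (2 * k)) ≤ expSum S k := by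
  have h := (Slin.summable hS k).le_tsum 0 (fun j _ => (Real.exp_pos _).le)
  simpa [expSum] using h

theorem Slin.expSum_pos (hS : S ∈ Slin) (k : ℤ) : 0 < expSum S k :=
  (Real.exp_pos _).trans_le (Slin.exp_le_expSum hS k)

theorem Slin.exp_logSumExp (hS : S ∈ Slin) (k : ℤ) : Real.exp (logSumExp S k) = expSum S k :=
  Real.exp_log (Slin.expSum_pos hS k)

theorem Slin.le_logSumExp (hS : S ∈ Slin) (k : ℤ) : S (2 * k) ≤ logSumExp S k := by
  rw [← Real.exp_le_exp, Slin.exp_logSumExp hS]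
  exact Slin.exp_le_expSum hS k

/-- A lower bound up to a multiple of `1 / k` gives every smaller constant as an eventual lower
bound. -/
theorem eventually_gt_of_linear_bound {l : Filter ℤ}
    (hl : Tendsto (fun n : ℤ => ((n : ℝ))⁻¹) l (𝓝 0)) {f : ℤ → ℝ} {b a d : ℝ}
    (hf : ∀ᶠ k : ℤ in l, b + d * ((k : ℝ))⁻¹ ≤ f k) (hab : a < b) : ∀ᶠ k in l, a < f k := by
  have h := (hl.const_mul d).const_add b
  rw [mul_zero, add_zero] at h
  filter_upwards [hf, h.eventually (lt_mem_nhds hab)] with k h1 h2 using h2.trans_le h1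

theorem Slin.tendsto_logSumExp_atBot (hS : S ∈ Slin) {c : ℝ} (hc : 0 < c)
    (h : Tendsto (fun n : ℤ => S n / (n : ℝ)) atBot (𝓝 c)) :
    Tendsto (fun k : ℤ => logSumExp S k / (k : ℝ)) atBot (𝓝 (2 * c)) := by
  have h2 : Tendsto (fun k : ℤ => S (2 * k) / (k : ℝ)) atBot (𝓝 (2 * c)) := by
    simpa using Slin.tendsto_atBot h 0
  rw [tendsto_order]
  refine ⟨fun a ha => ?_, fun a ha => ?_⟩
  · obtain ⟨b, hb, hb2⟩ := exists_between (max_lt ha (by linarith : 0 < 2 * c))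
    have hb0 : 0 < b := (le_max_right _ _).trans_lt hb
    obtain ⟨K, hK⟩ := eventually_atBot.1 (h2.eventually (lt_mem_nhds hb2))
    have hgs : Summable fun j : ℕ => Real.exp (-b) ^ j :=
      summable_geometric_of_lt_one (Real.exp_pos _).le (Real.exp_lt_one_iff.2 (by linarith))
    set G := ∑' j : ℕ, Real.exp (-b) ^ j with hG
    have hGpos : 0 < G := hgs.tsum_pos (fun j => by positivity) 0 (by simp)
    refine eventually_gt_of_linear_bound (d := Real.log G) tendsto_intCast_inv_atBot ?_
      ((le_max_left _ _).trans_lt hb)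
    filter_upwards [eventually_le_atBot K, eventually_lt_atBot 0] with k hk hk0
    have hk0' : (k : ℝ) < 0 := by exact_mod_cast hk0
    -- termwise comparison with the geometric series of ratio `exp (-b)`
    have hE : expSum S k ≤ Real.exp (k * b) * G := by
      rw [hG, ← tsum_mul_left]
      refine (Slin.summable hS k).tsum_le_tsum (fun j => ?_) (hgs.mul_left _)
      have h3 := hK (k - j) (by omega)
      have hneg : ((k - j : ℤ) : ℝ) < 0 := by exact_mod_cast (by omega : k - (j : ℤ) < 0)
      rw [lt_div_iff_of_neg hneg] at h3
      rw [← Real.exp_nat_mul, ← Real.exp_add]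
      refine Real.exp_le_exp.2 ?_
      push_cast at h3
      linarith
    have hL : logSumExp S k ≤ k * b + Real.log G := by
      have := Real.log_le_log (Slin.expSum_pos hS k) hE
      rwa [Real.log_mul (Real.exp_ne_zero _) hGpos.ne', Real.log_exp] at this
    rw [le_div_iff_of_neg hk0']
    have : (k : ℝ)⁻¹ * k = 1 := inv_mul_cancel₀ hk0'.ne
    calc logSumExp S k ≤ k * b + Real.log G := hL
      _ = k * b + Real.log G * ((k : ℝ)⁻¹ * k) := by rw [this, mul_one]
      _ = _ := by ring
  · filter_upwards [h2.eventually (gt_mem_nhds ha), eventually_lt_atBot 0] with k hk hk0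
    have hk0' : (k : ℝ) < 0 := by exact_mod_cast hk0
    exact lt_of_le_of_lt (div_le_div_of_nonpos_of_le hk0'.le (Slin.le_logSumExp hS k)) hk

theorem Slin.tendsto_logSumExp_atTop (hS : S ∈ Slin) {c : ℝ} (hc : 0 < c)
    (h : Tendsto (fun n : ℤ => S n / (n : ℝ)) atTop (𝓝 c)) :
    Tendsto (fun k : ℤ => logSumExp S k / (k : ℝ)) atTop (𝓝 (2 * c)) := by
  have h2 : Tendsto (fun k : ℤ => S (2 * k) / (k : ℝ)) atTop (𝓝 (2 * c)) := by
    simpa using Slin.tendsto_atTop h 0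
  rw [tendsto_order]
  refine ⟨fun a ha => ?_, fun a ha => ?_⟩
  · filter_upwards [h2.eventually (lt_mem_nhds ha), eventually_gt_atTop 0] with k hk hk0
    have hk0' : (0 : ℝ) < k := by exact_mod_cast hk0
    exact lt_of_lt_of_le hk (div_le_div_of_nonneg_right (Slin.le_logSumExp hS k) hk0'.le)
  · obtain ⟨b, hb, hb2⟩ := exists_between ha
    have hb0 : 0 < b := by linarith
    obtain ⟨K', hK'⟩ := eventually_atTop.1 (h2.eventually (gt_mem_nhds hb))
    obtain ⟨K, hKK, hK0⟩ : ∃ K : ℤ, K' ≤ K ∧ 0 < K := ⟨max K' 1, le_max_left _ _, by omega⟩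
    have hS2 : ∀ k : ℤ, K ≤ k → S (2 * k) ≤ k * b := fun k hk => by
      have h3 := hK' k (by omega)
      have hpos : (0 : ℝ) < k := by exact_mod_cast (by omega : 0 < k)
      rw [div_lt_iff₀ hpos] at h3
      linarith
    have hq : 0 < 1 - Real.exp (-b) := by
      have := Real.exp_lt_one_iff.2 (by linarith : -b < 0)
      linarith
    -- `C` is large enough for the bound at `K`, and for the induction step of the bound
    set C := max (expSum S K * Real.exp (-(K * b))) (1 - Real.exp (-b))⁻¹ with hC
    have hCpos : 0 < C := (inv_pos.2 hq).trans_le (le_max_right _ _)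
    have hC1 : 1 ≤ C * (1 - Real.exp (-b)) :=
      (inv_mul_cancel₀ hq.ne').ge.trans
        (mul_le_mul_of_nonneg_right (le_max_right _ _) hq.le)
    have hE : ∀ k : ℤ, K ≤ k → expSum S k ≤ C * Real.exp (k * b) := by
      intro k hk
      induction k, hk using Int.leInduction with
      | base =>
        have : expSum S K * Real.exp (-(K * b)) * Real.exp (K * b) ≤ C * Real.exp (K * b) :=
          mul_le_mul_of_nonneg_right (le_max_left _ _) (Real.exp_pos _).le
        rwa [mul_assoc, ← Real.exp_add, neg_add_cancel, Real.exp_zero, mul_one] at this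
      | succ k hk ih =>
        have e1 := Slin.expSum_sub hS (k + 1)
        rw [add_sub_cancel_right] at e1
        have e2 := Real.exp_le_exp.2 (hS2 (k + 1) (by omega))
        have e3 : Real.exp (k * b) = Real.exp (((k + 1 : ℤ) : ℝ) * b) * Real.exp (-b) := by
          rw [← Real.exp_add]; congr 1; push_cast; ring
        rw [e3] at ih
        have e4 := mul_le_mul_of_nonneg_right hC1 (Real.exp_pos (((k + 1 : ℤ) : ℝ) * b)).le
        linarith
    have hgt := eventually_gt_of_linear_bound (f := fun k : ℤ => -(logSumExp S k / (k : ℝ)))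
      (b := -b) (a := -a) (d := -Real.log C) tendsto_intCast_inv_atTop ?_ (by linarith)
    · exact hgt.mono fun k hk => by linarith
    filter_upwards [eventually_ge_atTop K] with k hk
    have hk0' : (0 : ℝ) < k := by exact_mod_cast (by omega : 0 < k)
    have hL : logSumExp S k ≤ Real.log C + k * b := by
      have := Real.log_le_log (Slin.expSum_pos hS k) (hE k hk)
      rwa [Real.log_mul hCpos.ne' (Real.exp_ne_zero _), Real.log_exp] at this
    have : logSumExp S k / k ≤ b + Real.log C * (k : ℝ)⁻¹ := by
      rw [div_le_iff₀ hk0']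
      calc logSumExp S k ≤ Real.log C + k * b := hL
        _ = k * b + Real.log C * ((k : ℝ)⁻¹ * k) := by
          rw [inv_mul_cancel₀ hk0'.ne', mul_one, add_comm]
        _ = _ := by ring
    linarith

/-! ### The path map on asymptotically linear paths -/

theorem step_even (S : ℤ → ℝ) (k : ℤ) :
    step S (2 * k) = 2 * logSumExp S k - S (2 * k + 1) := by
  have h : Odd (2 * k + 1) := ⟨k, rfl⟩
  simp only [step, shift, pitman, pastMax, if_pos h]
  congr 3
  omega

theorem step_odd (S : ℤ → ℝ) (k : ℤ) :
    step S (2 * k + 1) = logSumExp S (k + 1) + logSumExp S k - S (2 * k + 2) := by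
  have h : ¬ Odd (2 * k + 1 + 1) := by rw [Int.not_odd_iff_even]; exact ⟨k + 1, by ring⟩
  simp only [step, shift, pitman, pastMax, if_neg h]
  rw [show (2 * k + 1 + 1 + 1 - 1) / 2 = k + 1 by omega,
    show (2 * k + 1 + 1 - 1 - 1) / 2 = k by omega, show 2 * k + 1 + 1 = 2 * k + 2 by ring]
  ring

theorem tendsto_comp_sub_one_div {l : Filter ℤ} (hl : Tendsto (fun n : ℤ => ((n : ℝ))⁻¹) l (𝓝 0))
    (h0 : ∀ᶠ n in l, n ≠ 0) (hs : Tendsto (fun n : ℤ => n - 1) l l) {f : ℤ → ℝ} {c : ℝ}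
    (hf : Tendsto (fun n : ℤ => f n / (n : ℝ)) l (𝓝 c)) :
    Tendsto (fun n : ℤ => f (n - 1) / (n : ℝ)) l (𝓝 c) := by
  have h : Tendsto (fun n : ℤ => ((n - 1 : ℤ) : ℝ) / n) l (𝓝 1) := by
    have h := hl.const_sub 1
    rw [sub_zero] at h
    refine h.congr' (h0.mono fun k hk => ?_)
    have : (k : ℝ) ≠ 0 := by exact_mod_cast hk
    push_cast
    field_simp
  have h2 := (hf.comp hs).mul h
  rw [mul_one] at h2
  refine h2.congr' ((hs.eventually h0).mono fun k hk => ?_)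
  have : ((k - 1 : ℤ) : ℝ) ≠ 0 := by exact_mod_cast hk
  simp only [Function.comp]
  field_simp

theorem step_mem_Slin (hS : S ∈ Slin) : step S ∈ Slin := by
  obtain ⟨⟨c, hc, h⟩, d, hd, k⟩ := id hS
  have key : ∀ (l : Filter ℤ) (c : ℝ), Tendsto (fun n : ℤ => ((n : ℝ))⁻¹) l (𝓝 0) →
      (∀ᶠ n in l, n ≠ 0) → Tendsto (fun n : ℤ => n - 1) l l →
      (∀ r : ℤ, Tendsto (fun k : ℤ => S (2 * k + r) / (k : ℝ)) l (𝓝 (2 * c))) →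
      Tendsto (fun k : ℤ => logSumExp S k / (k : ℝ)) l (𝓝 (2 * c)) →
      Tendsto (fun k : ℤ => step S (2 * k) / (k : ℝ)) l (𝓝 (2 * c)) ∧
      Tendsto (fun k : ℤ => step S (2 * k - 1) / (k : ℝ)) l (𝓝 (2 * c)) := by
    intro l c h1 h2 h3 h4 h5
    constructor
    · convert (h5.const_mul 2).sub (h4 1) using 2
      · rw [step_even]; ring
      · ring
    · convert (h5.add (tendsto_comp_sub_one_div h1 h2 h3 h5)).sub (h4 0) using 2 with k
      · have := step_odd S (k - 1)
        rw [show 2 * (k - 1) + 1 = 2 * k - 1 by ring, sub_add_cancel,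
          show 2 * (k - 1) + 2 = 2 * k + 0 by ring] at this
        rw [this]; ring
      · ring
  refine Slin.of_parity ⟨2 * c, by linarith, ?_⟩ ⟨2 * d, by linarith, ?_⟩
  · exact key _ c tendsto_intCast_inv_atTop eventually_ne_zero_atTop
      (tendsto_atTop_add_const_right _ _ tendsto_id) (Slin.tendsto_atTop h)
      (Slin.tendsto_logSumExp_atTop hS hc h)
  · exact key _ d tendsto_intCast_inv_atBot eventually_ne_zero_atBot
      (tendsto_atBot_add_const_right _ _ tendsto_id) (Slin.tendsto_atBot k)
      (Slin.tendsto_logSumExp_atBot hS hd k)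

/-! ### Reflection and the inverse of the path map -/

/-- Reflection of a path in the origin, combined with the unit shift that exchanges even and odd
sites. It conjugates the path map to its inverse. -/
def reflect (S : ℤ → ℝ) (n : ℤ) : ℝ := -S (1 - n)

theorem reflect_reflect (S : ℤ → ℝ) : reflect (reflect S) = S := by
  funext n
  simp [reflect]

theorem tendsto_reflect {l l' : Filter ℤ} (hl : Tendsto (fun n : ℤ => ((n : ℝ))⁻¹) l' (𝓝 0))
    (h0 : ∀ᶠ n in l', n ≠ 0) (hr : Tendsto (fun n : ℤ => 1 - n) l' l) {c : ℝ}
    (h : Tendsto (fun n : ℤ => S n / (n : ℝ)) l (𝓝 c)) (h1 : ∀ᶠ n in l, n ≠ 0) :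
    Tendsto (fun n : ℤ => reflect S n / (n : ℝ)) l' (𝓝 c) := by
  have h2 := (h.comp hr).mul (hl.const_sub 1)
  rw [sub_zero, mul_one] at h2
  refine h2.congr' ((h0.and (hr.eventually h1)).mono fun n hn => ?_)
  have e0 : (n : ℝ) ≠ 0 := by exact_mod_cast hn.1
  have e1 : (1 : ℝ) - n ≠ 0 := by exact_mod_cast hn.2
  simp only [Function.comp, reflect]
  push_cast
  field_simp
  ring

theorem reflect_mem_Slin (hS : S ∈ Slin) : reflect S ∈ Slin := by
  obtain ⟨⟨c, hc, h⟩, d, hd, k⟩ := hS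
  refine ⟨⟨d, hd, tendsto_reflect tendsto_intCast_inv_atTop eventually_ne_zero_atTop ?_ k
      eventually_ne_zero_atBot⟩,
    ⟨c, hc, tendsto_reflect tendsto_intCast_inv_atBot eventually_ne_zero_atBot ?_ h
      eventually_ne_zero_atTop⟩⟩
  · exact tendsto_atBot.2 fun b => (eventually_ge_atTop (1 - b)).mono fun k hk => by omega
  · exact tendsto_atTop.2 fun b => (eventually_le_atBot (1 - b)).mono fun k hk => by omega

theorem Slin.tendsto_expSum_atTop (hS : S ∈ Slin) : Tendsto (expSum S) atTop atTop := by
  obtain ⟨⟨c, hc, h⟩, -⟩ := id hS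
  have h1 : Tendsto (fun k : ℤ => logSumExp S k / (k : ℝ) * k) atTop atTop :=
    (Slin.tendsto_logSumExp_atTop hS hc h).pos_mul_atTop (by linarith) tendsto_intCast_atTop_atTop
  refine (Real.tendsto_exp_atTop.comp h1).congr' (eventually_ne_zero_atTop.mono fun k hk => ?_)
  have : (k : ℝ) ≠ 0 := by exact_mod_cast hk
  rw [Function.comp, div_mul_cancel₀ _ this, Slin.exp_logSumExp hS]

theorem Slin.tendsto_expSum_atBot (hS : S ∈ Slin) : Tendsto (expSum S) atBot (𝓝 0) := by
  obtain ⟨-, c, hc, h⟩ := id hS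
  have h1 : Tendsto (fun k : ℤ => logSumExp S k / (k : ℝ) * k) atBot atBot :=
    (Slin.tendsto_logSumExp_atBot hS hc h).pos_mul_atBot (by linarith)
      (tendsto_intCast_atBot_iff.2 tendsto_id)
  refine (Real.tendsto_exp_atBot.comp h1).congr' (eventually_ne_zero_atBot.mono fun k hk => ?_)
  have : (k : ℝ) ≠ 0 := by exact_mod_cast hk
  rw [Function.comp, div_mul_cancel₀ _ this, Slin.exp_logSumExp hS]

theorem Slin.exp_neg_step_odd (hS : S ∈ Slin) (k : ℤ) :
    Real.exp (-step S (2 * k + 1)) = (expSum S k)⁻¹ - (expSum S (k + 1))⁻¹ := by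
  have h := Slin.expSum_sub hS (k + 1)
  rw [add_sub_cancel_right, show 2 * (k + 1) = 2 * k + 2 by ring] at h
  have h0 := Slin.expSum_pos hS k
  have h1 := Slin.expSum_pos hS (k + 1)
  rw [step_odd, neg_sub, Real.exp_sub, Real.exp_add, Slin.exp_logSumExp hS, Slin.exp_logSumExp hS,
    ← h]
  field_simp

/-- The identity `∑_{k ≥ m} exp (-step S (2k+1)) = 1 / expSum S m`, by telescoping, read through
the reflection. -/
theorem Slin.expSum_reflect_step (hS : S ∈ Slin) (k : ℤ) :
    expSum (reflect (step S)) k = (expSum S (-k))⁻¹ := by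
  have h : ∀ j : ℕ, Real.exp (reflect (step S) (2 * (k - (j : ℤ)))) =
      (expSum S (-k + j))⁻¹ - (expSum S (-k + (j + 1 : ℕ)))⁻¹ := fun j => by
    have := Slin.exp_neg_step_odd hS (-k + j)
    rw [show -k + ((j + 1 : ℕ) : ℤ) = -k + j + 1 by push_cast; ring, ← this, reflect]
    congr 3
    ring
  refine HasSum.tsum_eq ?_
  rw [hasSum_iff_tendsto_nat_of_nonneg (fun j => (Real.exp_pos _).le)]
  simp only [h, Finset.sum_range_sub' (fun j : ℕ => (expSum S (-k + (j : ℤ)))⁻¹)]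
  have h1 : Tendsto (fun n : ℕ => -k + (n : ℤ)) atTop atTop :=
    tendsto_atTop_add_const_left _ _ tendsto_natCast_atTop_atTop
  have h2 := ((Slin.tendsto_expSum_atTop hS).comp h1).inv_tendsto_atTop.const_sub (expSum S (-k))⁻¹
  simpa using h2

theorem Slin.logSumExp_reflect_step (hS : S ∈ Slin) (k : ℤ) :
    logSumExp (reflect (step S)) k = -logSumExp S (-k) := by
  have h := Slin.expSum_reflect_step hS k
  change Real.log (expSum _ _) = -Real.log (expSum _ _)
  rw [h, Real.log_inv]

theorem Slin.step_reflect_step (hS : S ∈ Slin) : step (reflect (step S)) = reflect S := by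
  funext n
  obtain ⟨k, rfl | rfl⟩ : ∃ k, n = 2 * k ∨ n = 2 * k + 1 := ⟨n / 2, by omega⟩
  · have h := step_even S (-k)
    rw [step_even, Slin.logSumExp_reflect_step hS, reflect, reflect,
      show 1 - (2 * k + 1) = 2 * -k by ring, h, show 2 * -k + 1 = 1 - 2 * k by ring]
    ring
  · have h := step_odd S (-k - 1)
    rw [step_odd, Slin.logSumExp_reflect_step hS, Slin.logSumExp_reflect_step hS, reflect, reflect,
      show 1 - (2 * k + 2) = 2 * (-k - 1) + 1 by ring, h, sub_add_cancel,
      show 2 * (-k - 1) + 2 = 1 - (2 * k + 1) by ring, show -(k + 1) = -k - 1 by ring]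
    ring

theorem bijOn_step : Set.BijOn step Slin Slin := by
  refine ⟨fun S hS => step_mem_Slin hS, fun S hS S' hS' h => ?_, fun S hS => ?_⟩
  · have h1 := Slin.step_reflect_step hS
    rw [h, Slin.step_reflect_step hS'] at h1
    rw [← reflect_reflect S, ← h1, reflect_reflect]
  · refine ⟨reflect (step (reflect S)), reflect_mem_Slin (step_mem_Slin (reflect_mem_Slin hS)), ?_⟩
    rw [Slin.step_reflect_step (reflect_mem_Slin hS), reflect_reflect]

/-! ### The two-sided iteration -/

theorem invFunOn_mem_Slin (hS : S ∈ Slin) : Function.invFunOn step Slin S ∈ Slin :=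
  Function.invFunOn_mem (bijOn_step.surjOn hS)

theorem iter_mem_Slin (hS : S ∈ Slin) : ∀ t : ℤ, iter t S ∈ Slin
  | Int.ofNat k => (bijOn_step.mapsTo.iterate k) hS
  | Int.negSucc k => Set.MapsTo.iterate (fun _ h => invFunOn_mem_Slin h) (k + 1) hS

theorem iter_zero (S : ℤ → ℝ) : iter 0 S = S := rfl

theorem iter_add_one (hS : S ∈ Slin) (t : ℤ) : iter (t + 1) S = step (iter t S) := by
  obtain k | k := t
  · exact Function.iterate_succ_apply' step k S
  · have h1 : iter (Int.negSucc k + 1) S = (Function.invFunOn step Slin)^[k] S := by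
      cases k <;> rfl
    have h2 : (Function.invFunOn step Slin)^[k] S ∈ Slin :=
      Set.MapsTo.iterate (fun _ h => invFunOn_mem_Slin h) k hS
    have h3 : iter (Int.negSucc k) S =
        Function.invFunOn step Slin ((Function.invFunOn step Slin)^[k] S) :=
      Function.iterate_succ_apply' _ k S
    rw [h1, h3, Function.invFunOn_eq (bijOn_step.surjOn h2)]

theorem eq_iter {P : ℤ → ℤ → ℝ} (hP : ∀ t, P t ∈ Slin) (h : ∀ t, P (t + 1) = step (P t)) (t : ℤ) :
    P t = iter t (P 0) := by
  induction t using Int.induction_on with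
  | zero => rfl
  | succ i ih => rw [h, ih, iter_add_one (hP 0)]
  | pred i ih =>
    have h1 := h (-i - 1)
    have h2 := iter_add_one (hP 0) (-i - 1)
    rw [sub_add_cancel] at h1 h2
    rw [ih, h2] at h1
    exact (bijOn_step.injOn (iter_mem_Slin (hP 0) _) (hP _) h1).symm

/-! ### Flows: uniqueness of the path dynamics without growth conditions at later times -/

/-- A family of paths `S t` evolving by the formulas that define `step`, except that in place of the
convergent sum `expSum (S t)` there is an arbitrary positive sequence `F t` having the same
increments. Both equations of the discrete Toda type encode as such families. -/
structure IsFlow (S F : ℤ → ℤ → ℝ) : Prop where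
  pos : ∀ t n, 0 < F t n
  sub : ∀ t n, F t n - F t (n - 1) = Real.exp (S t (2 * n))
  even : ∀ t n, S (t + 1) (2 * n) = 2 * Real.log (F t n) - S t (2 * n + 1)
  odd : ∀ t n, S (t + 1) (2 * n + 1) =
    Real.log (F t (n + 1)) + Real.log (F t n) - S t (2 * n + 2)

variable {P F : ℤ → ℤ → ℝ}

/-- A flow stays a flow under the reflection combined with time reversal. -/
theorem IsFlow.reflect (h : IsFlow P F) :
    IsFlow (fun t => DToda.reflect (P (-t))) (fun t n => (F (-t - 1) (-n))⁻¹) where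
  pos t n := inv_pos.2 (h.pos _ _)
  sub t n := by
    have h1 := h.odd (-t - 1) (-n)
    have h2 := h.sub (-t - 1) (-n + 1)
    have p0 := h.pos (-t - 1) (-n)
    have p1 := h.pos (-t - 1) (-n + 1)
    rw [sub_add_cancel] at h1
    rw [add_sub_cancel_right, show 2 * (-n + 1) = 2 * -n + 2 by ring] at h2
    simp only [DToda.reflect]
    rw [show 1 - 2 * n = 2 * -n + 1 by ring, h1, show -(n - 1) = -n + 1 by ring, neg_sub,
      Real.exp_sub, Real.exp_add, Real.exp_log p0, Real.exp_log p1, ← h2]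
    field_simp
  even t n := by
    have h1 := h.even (-t - 1) (-n)
    rw [sub_add_cancel] at h1
    simp only [DToda.reflect, Real.log_inv]
    rw [show 1 - (2 * n + 1) = 2 * -n by ring, h1, show 1 - 2 * n = 2 * -n + 1 by ring,
      show -(t + 1) = -t - 1 by ring]
    ring
  odd t n := by
    have h1 := h.odd (-t - 1) (-n - 1)
    rw [sub_add_cancel, sub_add_cancel] at h1
    simp only [DToda.reflect, Real.log_inv]
    rw [show 1 - (2 * n + 2) = 2 * (-n - 1) + 1 by ring, h1, show -(t + 1) = -t - 1 by ring,
      show 2 * (-n - 1) + 2 = 1 - (2 * n + 1) by ring, show -(n + 1) = -n - 1 by ring]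
    ring

/-- In a flow, `F t` can differ from `expSum (P t)` only by a constant `d`. If `d < 0`, then `F t`
is negative far to the left. If `d > 0`, then `F t` stays bounded below, so `P (t + 1)` tends to
`+∞` along even sites going to `-∞`, and `F (t + 1)` becomes negative far to the left. -/
theorem IsFlow.eq_expSum (h : IsFlow P F) {t : ℤ} (ht : P t ∈ Slin) (n : ℤ) :
    F t n = expSum (P t) n := by
  set d := F t 0 - expSum (P t) 0 with hd
  have hconst : ∀ n, F t n = expSum (P t) n + d := fun n => by
    induction n using Int.induction_on with
    | zero => simp [hd]
    | succ i ih =>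
      have h1 := h.sub t (i + 1)
      have h2 := Slin.expSum_sub ht (i + 1)
      rw [add_sub_cancel_right] at h1 h2
      linarith
    | pred i ih =>
      have h1 := h.sub t (-i)
      have h2 := Slin.expSum_sub ht (-i)
      linarith
  have hlim := Slin.tendsto_expSum_atBot ht
  have hd0 : 0 ≤ d := by
    by_contra! hneg
    obtain ⟨k, hk⟩ := (hlim.eventually (gt_mem_nhds (neg_pos.2 hneg))).exists
    have := h.pos t k
    rw [hconst k] at this
    linarith
  rcases hd0.eq_or_lt with h0 | hpos
  · rw [hconst, ← h0, add_zero]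
  exfalso
  obtain ⟨-, c, hc, hS⟩ := id ht
  have h1 : Tendsto (fun k : ℤ => P t (2 * k + 1)) atBot atBot := by
    have := (Slin.tendsto_atBot hS 1).pos_mul_atBot (by linarith)
      (tendsto_intCast_atBot_iff.2 tendsto_id)
    refine this.congr' (eventually_ne_zero_atBot.mono fun k hk => ?_)
    have : (k : ℝ) ≠ 0 := by exact_mod_cast hk
    simp only [id]
    field_simp
  obtain ⟨K, hK⟩ := eventually_atBot.1 (tendsto_atBot.1 h1 (2 * Real.log d))
  have h2 : ∀ k ≤ K, 1 ≤ F (t + 1) k - F (t + 1) (k - 1) := fun k hk => by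
    rw [h.sub, h.even]
    refine Real.one_le_exp ?_
    have h3 : Real.log d ≤ Real.log (F t k) := by
      refine Real.log_le_log hpos ?_
      rw [hconst]
      linarith [Slin.expSum_pos ht k]
    linarith [hK k hk]
  have h3 : ∀ j : ℕ, F (t + 1) (K - j) ≤ F (t + 1) K - j := fun j => by
    induction j with
    | zero => simp
    | succ j ih =>
      have := h2 (K - j) (by omega)
      push_cast
      rw [show K - ((j : ℤ) + 1) = K - j - 1 by ring]
      linarith
  obtain ⟨j, hj⟩ := exists_nat_gt (F (t + 1) K)
  linarith [h3 j, h.pos (t + 1) (K - j)]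

theorem IsFlow.log_eq (h : IsFlow P F) {t : ℤ} (ht : P t ∈ Slin) (n : ℤ) :
    Real.log (F t n) = logSumExp (P t) n := by
  rw [h.eq_expSum ht]
  rfl

theorem IsFlow.eq_step (h : IsFlow P F) {t : ℤ} (ht : P t ∈ Slin) : P (t + 1) = step (P t) := by
  funext n
  obtain ⟨k, rfl | rfl⟩ : ∃ k, n = 2 * k ∨ n = 2 * k + 1 := ⟨n / 2, by omega⟩
  · rw [h.even, step_even, h.log_eq ht]
  · rw [h.odd, step_odd, h.log_eq ht, h.log_eq ht]

theorem IsFlow.mem_Slin_nat (h : IsFlow P F) (h0 : P 0 ∈ Slin) (k : ℕ) : P k ∈ Slin := by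
  induction k with
  | zero => exact h0
  | succ k ih =>
    push_cast
    rw [h.eq_step ih]
    exact step_mem_Slin ih

theorem IsFlow.mem_Slin (h : IsFlow P F) (h0 : P 0 ∈ Slin) (t : ℤ) : P t ∈ Slin := by
  obtain ⟨k, rfl | rfl⟩ := Int.eq_nat_or_neg t
  · exact h.mem_Slin_nat h0 k
  · rw [← reflect_reflect (P _)]
    exact reflect_mem_Slin (h.reflect.mem_Slin_nat (by simpa using reflect_mem_Slin h0) k)

theorem IsFlow.eq_iter (h : IsFlow P F) (h0 : P 0 ∈ Slin) (t : ℤ) : P t = iter t (P 0) :=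
  DToda.eq_iter (h.mem_Slin h0) (fun t => h.eq_step (h.mem_Slin h0 t)) t

/-! ### Path encodings and initial configurations -/

/-- Telescoping for signed sums. -/
theorem signedSum_gradSeq (g : ℤ → ℝ) (a n : ℤ) :
    signedSum (gradSeq g) a n = g n - g (a - 1) := by
  induction n using Int.inductionOn' (b := a - 1) with
  | zero =>
    have := signedSum_self (gradSeq g) (a - 1)
    rw [sub_add_cancel] at this
    rw [this, sub_self]
  | succ k _ ih => rw [signedSum_succ, ih, gradSeq, add_sub_cancel_right]; ring
  | pred k _ ih =>
    have h := signedSum_succ (gradSeq g) a (k - 1)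
    rw [sub_add_cancel, ih, gradSeq] at h
    linarith

/-- Two integer-indexed sequences with the same increments and the same value at `0` agree. -/
theorem eq_of_sub_eq {f g : ℤ → ℝ} (h0 : f 0 = g 0) (h : ∀ n, f (n + 1) - f n = g (n + 1) - g n)
    (n : ℤ) : f n = g n := by
  induction n using Int.induction_on with
  | zero => exact h0
  | succ i ih => linarith [h i]
  | pred i ih =>
    have := h (-i - 1)
    rw [sub_add_cancel] at this
    linarith

/-- The path `S` has the increments prescribed by the configuration `(I, J)`; its value at `0` is
free. -/
structure Encodes (S I J : ℤ → ℝ) : Prop where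
  incrI : ∀ n, S (2 * n + 1) - S (2 * n) = Real.log (I (n + 1))
  incrJ : ∀ n, S (2 * n) - S (2 * n - 1) = -Real.log (J n)

theorem encodes_const_add_pathEncoding (c : ℝ) (I J : ℤ → ℝ) :
    Encodes (fun n => c + pathEncoding I J n) I J where
  incrI n := by
    have h := pathEncoding_sub I J (2 * n + 1)
    rw [add_sub_cancel_right, pathIncr, if_pos ⟨n, rfl⟩,
      show (2 * n + 1 + 1) / 2 = n + 1 by omega] at h
    linarith
  incrJ n := by
    have h := pathEncoding_sub I J (2 * n)
    rw [pathIncr, if_neg (by rw [Int.not_odd_iff_even]; exact ⟨n, by ring⟩),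
      show 2 * n / 2 = n by omega] at h
    linarith

theorem Slin.const_add {S : ℤ → ℝ} (c : ℝ) (hS : S ∈ Slin) : (fun n => c + S n) ∈ Slin := by
  obtain ⟨⟨a, ha, h⟩, b, hb, k⟩ := hS
  refine ⟨⟨a, ha, ?_⟩, b, hb, ?_⟩
  · have := (tendsto_intCast_inv_atTop.const_mul c).add h
    rw [mul_zero, zero_add] at this
    exact this.congr fun n => by ring
  · have := (tendsto_intCast_inv_atBot.const_mul c).add k
    rw [mul_zero, zero_add] at this
    exact this.congr fun n => by ring

theorem Encodes.signedSum_eq {S I J : ℤ → ℝ} (h : Encodes S I J) (n : ℤ) :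
    signedSum (fun m => Real.log (J m) - Real.log (I m)) 1 n = S 0 - S (2 * n) := by
  have : (fun m => Real.log (J m) - Real.log (I m)) = gradSeq fun m => -S (2 * m) := by
    funext m
    have h1 := h.incrI (m - 1)
    have h2 := h.incrJ m
    rw [sub_add_cancel, show 2 * (m - 1) + 1 = 2 * m - 1 by ring] at h1
    simp only [gradSeq]
    linarith
  rw [this, signedSum_gradSeq]
  norm_num
  ring

theorem Encodes.mem_Cdt {S I J : ℤ → ℝ} (h : Encodes S I J) (hS : S ∈ Slin) (hI : ∀ n, 0 < I n)
    (hJ : ∀ n, 0 < J n) : (I, J) ∈ Cdt := by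
  obtain ⟨⟨c, hc, hS⟩, d, hd, hS'⟩ := hS
  refine ⟨hI, hJ, ⟨-(2 * c), by linarith, ?_, ?_⟩, ⟨-(2 * d), by linarith, ?_, ?_⟩⟩
  · have := (tendsto_intCast_inv_atTop.const_mul (S 0)).sub (Slin.tendsto_atTop hS 0)
    rw [mul_zero, zero_sub] at this
    refine this.congr fun n => ?_
    rw [h.signedSum_eq, add_zero]
    ring
  · have := (tendsto_intCast_inv_atTop.const_mul (S 0)).sub (Slin.tendsto_atTop hS 1)
    rw [mul_zero, zero_sub] at this
    refine this.congr fun n => ?_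
    simp only [h.signedSum_eq, ← h.incrI]
    ring
  · have := (tendsto_intCast_inv_atBot.const_mul (S 0)).sub (Slin.tendsto_atBot hS' 0)
    rw [mul_zero, zero_sub] at this
    refine this.congr fun n => ?_
    rw [h.signedSum_eq, add_zero]
    ring
  · have := (tendsto_intCast_inv_atBot.const_mul (S 0)).sub (Slin.tendsto_atBot hS' (-1))
    rw [mul_zero, zero_sub] at this
    refine this.congr fun n => ?_
    have h1 := h.incrJ n
    have h2 : Real.log (J n) = S (2 * n + -1) - S (2 * n) := by
      rw [show 2 * n + -1 = 2 * n - 1 by ring]; linarith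
    simp only [h.signedSum_eq, h2]
    ring

variable (x y : ℤ → ℝ)

theorem encodes_initPath : Encodes (initPath x y) (initI y) (initJ x y) :=
  encodes_const_add_pathEncoding _ _ _

theorem initPath_even (n : ℤ) : initPath x y (2 * n) = 2 * y n - x (n + 1) + x n := by
  refine eq_of_sub_eq (f := fun n => initPath x y (2 * n))
    (g := fun n => 2 * y n - x (n + 1) + x n) ?_ (fun n => ?_) n
  · simp only [initPath, mul_zero, pathEncoding_zero, gradSeq]
    norm_num
    ring
  · have h1 := (encodes_initPath x y).incrI n
    have h2 := (encodes_initPath x y).incrJ (n + 1)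
    rw [show 2 * (n + 1) - 1 = 2 * n + 1 by ring] at h2
    simp only [initI, initJ, Real.log_exp, gradSeq, add_sub_cancel_right] at h1 h2
    linarith

theorem initPath_odd (n : ℤ) : initPath x y (2 * n + 1) = y (n + 1) + y n - x (n + 1) + x n := by
  have h1 := (encodes_initPath x y).incrI n
  rw [initPath_even] at h1
  simp only [initI, Real.log_exp, gradSeq, add_sub_cancel_right] at h1
  linarith

variable {x y}

/-- The growth condition says exactly that the initial path is asymptotically linear, its even and
odd values being the numerators of the quotients in that condition. -/
theorem GrowthCondition.initPath_mem_Slin (h : GrowthCondition x y) : initPath x y ∈ Slin := by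
  have e0 : ∀ n, 2 * y n - gradSeq x (n + 1) = initPath x y (2 * n) := fun n => by
    rw [initPath_even, gradSeq, add_sub_cancel_right]; ring
  have e1 : ∀ n, y n + y (n - 1) - gradSeq x n = initPath x y (2 * n - 1) := fun n => by
    have := initPath_odd x y (n - 1)
    rw [show 2 * (n - 1) + 1 = 2 * n - 1 by ring, sub_add_cancel] at this
    rw [this, gradSeq]; ring
  simp only [GrowthCondition, e0, e1] at h
  exact Slin.of_parity h.1 h.2

theorem GrowthCondition.pathEncoding_mem_Slin (h : GrowthCondition x y) :
    pathEncoding (initI y) (initJ x y) ∈ Slin := by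
  have := Slin.const_add (-(2 * y 0 - gradSeq x 1)) h.initPath_mem_Slin
  have e : (fun n => -(2 * y 0 - gradSeq x 1) + initPath x y n) =
      pathEncoding (initI y) (initJ x y) := by
    funext n
    rw [initPath]
    ring
  rwa [e] at this

/-! ### Solutions of the discrete Toda equation as flows -/

variable {I J U : ℤ → ℤ → ℝ}

/-- The path encodings of a solution of the discrete Toda equation, with heights at `0` chosen so
that they form a flow. -/
noncomputable def todaPath (I J U : ℤ → ℤ → ℝ) (t n : ℤ) : ℝ :=
  signedSum (fun s => Real.log (I s 1) - 2 * Real.log (U s 1)) 0 (t - 1) +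
    pathEncoding (I t) (J t) n

theorem encodes_todaPath (t : ℤ) : Encodes (todaPath I J U t) (I t) (J t) :=
  encodes_const_add_pathEncoding _ _ _

theorem todaPath_zero : todaPath I J U 0 = pathEncoding (I 0) (J 0) := by
  funext n
  have := signedSum_self (fun s => Real.log (I s 1) - 2 * Real.log (U s 1)) (-1)
  rw [neg_add_cancel] at this
  simp [todaPath, this]

theorem IsTodaSolution.log_J (h : IsTodaSolution I J U) (t n : ℤ) :
    Real.log (J (t + 1) n) =
      Real.log (I t (n + 1)) + Real.log (J t n) - Real.log (I (t + 1) n) := by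
  rw [h.eqJ, Real.log_mul (mul_pos (h.posI _ _) (h.posJ _ _)).ne' (inv_pos.2 (h.posI _ _)).ne',
    Real.log_mul (h.posI _ _).ne' (h.posJ _ _).ne', Real.log_inv]
  ring

theorem IsTodaSolution.log_U (h : IsTodaSolution I J U) (t n : ℤ) :
    Real.log (U t (n + 1)) =
      Real.log (I t (n + 1)) + Real.log (U t n) - Real.log (I (t + 1) n) := by
  rw [h.eqU, Real.log_mul (mul_pos (h.posI _ _) (h.posU _ _)).ne' (inv_pos.2 (h.posI _ _)).ne',
    Real.log_mul (h.posI _ _).ne' (h.posU _ _).ne', Real.log_inv]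
  ring

theorem IsTodaSolution.todaPath_even (h : IsTodaSolution I J U) (t n : ℤ) :
    todaPath I J U (t + 1) (2 * n) =
      todaPath I J U t (2 * n + 1) - 2 * Real.log (U t (n + 1)) := by
  refine eq_of_sub_eq (f := fun n => todaPath I J U (t + 1) (2 * n))
    (g := fun n => todaPath I J U t (2 * n + 1) - 2 * Real.log (U t (n + 1))) ?_ (fun n => ?_) n
  · have h1 := signedSum_succ (fun s => Real.log (I s 1) - 2 * Real.log (U s 1)) 0 (t - 1)
    have h2 := (encodes_todaPath (I := I) (J := J) (U := U) t).incrI 0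
    simp only [sub_add_cancel, mul_zero, zero_add] at h1 h2 ⊢
    simp only [todaPath, pathEncoding_zero, add_sub_cancel_right, h1] at h2 ⊢
    linarith
  · have a1 := (encodes_todaPath (I := I) (J := J) (U := U) (t + 1)).incrI n
    have a2 := (encodes_todaPath (I := I) (J := J) (U := U) (t + 1)).incrJ (n + 1)
    have a3 := (encodes_todaPath (I := I) (J := J) (U := U) t).incrI (n + 1)
    have a4 := (encodes_todaPath (I := I) (J := J) (U := U) t).incrJ (n + 1)
    have a5 := h.log_J t (n + 1)
    have a6 := h.log_U t (n + 1)
    rw [show 2 * (n + 1) - 1 = 2 * n + 1 by ring] at a2 a4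
    linarith

theorem IsTodaSolution.isFlow (h : IsTodaSolution I J U) :
    IsFlow (todaPath I J U)
      (fun t n => Real.exp (todaPath I J U t (2 * n + 1)) / U t (n + 1)) := by
  have hlog : ∀ t n, Real.log (Real.exp (todaPath I J U t (2 * n + 1)) / U t (n + 1)) =
      todaPath I J U t (2 * n + 1) - Real.log (U t (n + 1)) := fun t n => by
    rw [Real.log_div (Real.exp_ne_zero _) (h.posU _ _).ne', Real.log_exp]
  refine ⟨fun t n => div_pos (Real.exp_pos _) (h.posU _ _), fun t n => ?_, fun t n => ?_,
    fun t n => ?_⟩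
  · have e1 : todaPath I J U t (2 * n + 1) = todaPath I J U t (2 * n) + Real.log (I t (n + 1)) := by
      linarith [(encodes_todaPath (I := I) (J := J) (U := U) t).incrI n]
    have e2 : todaPath I J U t (2 * (n - 1) + 1) = todaPath I J U t (2 * n) + Real.log (J t n) := by
      rw [show 2 * (n - 1) + 1 = 2 * n - 1 by ring]
      linarith [(encodes_todaPath (I := I) (J := J) (U := U) t).incrJ n]
    have p1 := h.posI t (n + 1)
    have p2 := h.posU t n
    have p3 := h.posI (t + 1) n
    have e3 := h.eqI t n
    rw [e1, e2, Real.exp_add, Real.exp_add, Real.exp_log p1, Real.exp_log (h.posJ t n),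
      sub_add_cancel, h.eqU]
    field_simp
    linarith
  · simp only [hlog, h.todaPath_even]
    ring
  · have a1 := (encodes_todaPath (I := I) (J := J) (U := U) (t + 1)).incrI n
    have a3 := (encodes_todaPath (I := I) (J := J) (U := U) t).incrI (n + 1)
    have a4 := (encodes_todaPath (I := I) (J := J) (U := U) t).incrJ (n + 1)
    have a6 := h.log_U t (n + 1)
    have a7 := h.todaPath_even t n
    rw [show 2 * (n + 1) - 1 = 2 * n + 1 by ring] at a4
    simp only [hlog]
    rw [show 2 * n + 2 = 2 * (n + 1) by ring]
    linarith

theorem IsTodaSolution.todaPath_eq (h : IsTodaSolution I J U)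
    (h0 : pathEncoding (I 0) (J 0) ∈ Slin) (t : ℤ) :
    todaPath I J U t = iter t (pathEncoding (I 0) (J 0)) := by
  have := h.isFlow.eq_iter (by rwa [todaPath_zero]) t
  rwa [todaPath_zero] at this

theorem IsTodaSolution.I_eq (h : IsTodaSolution I J U) (h0 : pathEncoding (I 0) (J 0) ∈ Slin)
    (t n : ℤ) : I t n = Real.exp (iter t (pathEncoding (I 0) (J 0)) (2 * n - 1)
      - iter t (pathEncoding (I 0) (J 0)) (2 * n - 2)) := by
  have := (encodes_todaPath (I := I) (J := J) (U := U) t).incrI (n - 1)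
  rw [h.todaPath_eq h0, sub_add_cancel, show 2 * (n - 1) + 1 = 2 * n - 1 by ring,
    show 2 * (n - 1) = 2 * n - 2 by ring] at this
  rw [this, Real.exp_log (h.posI _ _)]

theorem IsTodaSolution.J_eq (h : IsTodaSolution I J U) (h0 : pathEncoding (I 0) (J 0) ∈ Slin)
    (t n : ℤ) : J t n = Real.exp (-(iter t (pathEncoding (I 0) (J 0)) (2 * n)
      - iter t (pathEncoding (I 0) (J 0)) (2 * n - 1))) := by
  have := (encodes_todaPath (I := I) (J := J) (U := U) t).incrJ n
  rw [h.todaPath_eq h0] at this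
  rw [this, neg_neg, Real.exp_log (h.posJ _ _)]

theorem IsTodaSolution.U_eq (h : IsTodaSolution I J U) (h0 : pathEncoding (I 0) (J 0) ∈ Slin)
    (t n : ℤ) : U t n = Real.exp ((iter t (pathEncoding (I 0) (J 0)) (2 * n - 1)
      - iter (t + 1) (pathEncoding (I 0) (J 0)) (2 * n - 2)) / 2) := by
  have := h.todaPath_even t (n - 1)
  rw [h.todaPath_eq h0, h.todaPath_eq h0, sub_add_cancel, show 2 * (n - 1) + 1 = 2 * n - 1 by ring,
    show 2 * (n - 1) = 2 * n - 2 by ring] at this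
  rw [this, sub_sub_cancel, mul_div_cancel_left₀ _ two_ne_zero, Real.exp_log (h.posU _ _)]

theorem IsTodaSolution.mem_Cdt (h : IsTodaSolution I J U) (h0 : pathEncoding (I 0) (J 0) ∈ Slin)
    (t : ℤ) : (I t, J t) ∈ Cdt :=
  (encodes_todaPath (U := U) t).mem_Cdt (by rw [h.todaPath_eq h0]; exact iter_mem_Slin h0 t)
    (h.posI t) (h.posJ t)

/-! ### Solutions of the `τ`-function equation as flows -/

variable {τ : ℤ → ℤ → ℝ}

theorem IsTauSolution.exp_log (h : IsTauSolution τ) (t n : ℤ) :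
    Real.exp (logArray τ t n) = τ t n := Real.exp_log (h.pos t n)

/-- The logarithmic differences of a solution of the `τ`-function equation solve the discrete Toda
equation. The multiplicative relations for `J` and `U` are identities; the additive one is the
`τ`-function equation. -/
theorem IsTauSolution.isTodaSolution (h : IsTauSolution τ) :
    IsTodaSolution (tauI τ) (tauJ τ) (tauU τ) where
  posI _ _ := Real.exp_pos _
  posJ _ _ := Real.exp_pos _
  posU _ _ := Real.exp_pos _
  eqI t n := by
    have h1 := h.eq (t + 1) n
    rw [add_sub_cancel_right] at h1
    have p := h.pos
    have p1 := p t n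
    have p2 := p (t + 1) n
    have p3 := p (t + 1 + 1) n
    have p4 := p t (n - 1)
    have p5 := p (t + 1) (n - 1)
    have p6 := p (t + 1 + 1) (n - 1)
    simp only [tauI, tauJ, tauU, gradN, gradT, neg_sub, add_sub_cancel_right, Real.exp_add,
      Real.exp_sub, h.exp_log]
    field_simp
    linarith
  eqJ t n := by
    simp only [tauI, tauJ, ← Real.exp_neg, ← Real.exp_add, gradN, gradT, add_sub_cancel_right]
    congr 1
    ring
  eqU t n := by
    simp only [tauI, tauU, ← Real.exp_neg, ← Real.exp_add, gradN, gradT, add_sub_cancel_right]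
    congr 1
    ring

/-- The path attached to a `τ`-array at time `t`, for `n = 2 k` and `n = 2 k + 1` respectively. -/
noncomputable def tauPath (τ : ℤ → ℤ → ℝ) (t n : ℤ) : ℝ :=
  if Odd n then logArray τ (t + 1) (n / 2 + 1) + logArray τ (t + 1) (n / 2)
    - 2 * logArray τ t (n / 2 + 1)
  else 2 * logArray τ (t + 1) (n / 2) - logArray τ t (n / 2) - logArray τ t (n / 2 + 1)

theorem tauPath_even (τ : ℤ → ℤ → ℝ) (t k : ℤ) : tauPath τ t (2 * k) =
    2 * logArray τ (t + 1) k - logArray τ t k - logArray τ t (k + 1) := by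
  rw [tauPath, if_neg (by rw [Int.not_odd_iff_even]; exact ⟨k, by ring⟩),
    show 2 * k / 2 = k by omega]

theorem tauPath_odd (τ : ℤ → ℤ → ℝ) (t k : ℤ) : tauPath τ t (2 * k + 1) =
    logArray τ (t + 1) (k + 1) + logArray τ (t + 1) k - 2 * logArray τ t (k + 1) := by
  rw [tauPath, if_pos ⟨k, rfl⟩, show (2 * k + 1) / 2 = k by omega]

/-- After division by `τ_n^t τ_{n+1}^t` the `τ`-function equation at time `t + 1` says that
`τ_n^{t+2} / τ_{n+1}^t` has the increments `exp (tauPath τ t (2 n))`. -/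
theorem IsTauSolution.isFlow (h : IsTauSolution τ) :
    IsFlow (tauPath τ) (fun t n => τ (t + 2) n / τ t (n + 1)) := by
  have hlog : ∀ t n, Real.log (τ (t + 2) n / τ t (n + 1)) =
      logArray τ (t + 2) n - logArray τ t (n + 1) := fun t n =>
    Real.log_div (h.pos _ _).ne' (h.pos _ _).ne'
  refine ⟨fun t n => div_pos (h.pos _ _) (h.pos _ _), fun t n => ?_, fun t n => ?_, fun t n => ?_⟩
  · have h1 := h.eq (t + 1) n
    rw [add_sub_cancel_right, show t + 1 + 1 = t + 2 by ring] at h1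
    have p1 := h.pos t n
    have p2 := h.pos t (n + 1)
    rw [tauPath_even, two_mul, Real.exp_sub, Real.exp_sub, Real.exp_add, h.exp_log, h.exp_log,
      h.exp_log, sub_add_cancel]
    field_simp
    linarith
  · rw [tauPath_even, tauPath_odd, hlog, show t + 1 + 1 = t + 2 by ring]
    ring
  · rw [show 2 * n + 2 = 2 * (n + 1) by ring, tauPath_even, tauPath_odd, hlog, hlog,
      show t + 1 + 1 = t + 2 by ring]
    ring

theorem SolvesTauIVP.logArray_one (h : SolvesTauIVP x y τ) (n : ℤ) :
    logArray τ 1 n = x n + y n := by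
  have h1 := h.2.2 n
  have h2 := h.2.1 n
  simp only [gradT, zero_add] at h1
  rw [← h2, ← h1]
  simp [logArray]

theorem SolvesTauIVP.tauPath_zero (h : SolvesTauIVP x y τ) : tauPath τ 0 = initPath x y := by
  have h0 : ∀ n, logArray τ 0 n = x n := h.2.1
  funext n
  obtain ⟨k, rfl | rfl⟩ : ∃ k, n = 2 * k ∨ n = 2 * k + 1 := ⟨n / 2, by omega⟩
  · rw [tauPath_even, initPath_even, zero_add, h.logArray_one, h0, h0]
    ring
  · rw [tauPath_odd, initPath_odd, zero_add, h.logArray_one, h.logArray_one, h0]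
    ring

theorem SolvesTauIVP.tauPath_eq (h : SolvesTauIVP x y τ) (hxy : GrowthCondition x y) (t : ℤ) :
    tauPath τ t = iter t (initPath x y) := by
  have := h.1.isFlow.eq_iter (by rw [h.tauPath_zero]; exact hxy.initPath_mem_Slin) t
  rwa [h.tauPath_zero] at this

theorem SolvesTauIVP.tauI_zero (h : SolvesTauIVP x y τ) : tauI τ 0 = initI y := by
  funext n
  simp only [tauI, initI, gradN, gradSeq, h.2.2]

theorem SolvesTauIVP.tauJ_zero (h : SolvesTauIVP x y τ) : tauJ τ 0 = initJ x y := by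
  have h0 : ∀ n, logArray τ 0 n = x n := h.2.1
  funext n
  simp only [tauJ, initJ, gradN, gradSeq, h.2.2, h0, add_sub_cancel_right]
  congr 1
  ring

/-! ### The auxiliary array and the explicit formula -/

theorem IsAuxArray.eq {y₀ : ℝ} {S A A' : ℤ → ℤ → ℝ} (h : IsAuxArray y₀ S A)
    (h' : IsAuxArray y₀ S A') : A' = A := by
  funext t n
  refine eq_of_sub_eq (f := A' t) (g := A t) ?_ (fun n => by rw [h.space, h'.space]) n
  exact eq_of_sub_eq (f := fun t => A' t 0) (g := fun t => A t 0) (by rw [h.zero, h'.zero])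
    (fun t => by rw [h.time, h'.time]) t

theorem exists_isAuxArray (y₀ : ℝ) (S : ℤ → ℤ → ℝ) : ∃ A, IsAuxArray y₀ S A := by
  refine ⟨fun t n => y₀ + signedSum (fun s => (S s 1 + S (s + 1) 0 - 2 * S s 0) / 2) 0 (t - 1) +
    signedSum (fun m => S t (2 * m - 1) - S t (2 * m - 2)) 1 n, ?_, fun t => ?_, fun t n => ?_⟩
  · have h1 := signedSum_self (fun s => (S s 1 + S (s + 1) 0 - 2 * S s 0) / 2) (-1)
    have h2 := signedSum_self (fun m => S 0 (2 * m - 1) - S 0 (2 * m - 2)) 0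
    rw [neg_add_cancel] at h1
    rw [zero_add] at h2
    simp only [zero_sub, h1, h2, add_zero]
  · have h1 := signedSum_succ (fun s => (S s 1 + S (s + 1) 0 - 2 * S s 0) / 2) 0 (t - 1)
    have h2 : ∀ t, signedSum (fun m => S t (2 * m - 1) - S t (2 * m - 2)) 1 0 = 0 := fun t =>
      signedSum_self _ 0
    simp only [sub_add_cancel] at h1
    simp only [add_sub_cancel_right, h1, h2]
    ring
  · simp only [signedSum_succ]
    rw [show 2 * (n + 1) - 1 = 2 * n + 1 by ring, show 2 * (n + 1) - 2 = 2 * n by ring]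
    ring

theorem isAuxArray_gradT_logArray (τ : ℤ → ℤ → ℝ) :
    IsAuxArray (gradT (logArray τ) 0 0) (tauPath τ) (gradT (logArray τ)) where
  zero := rfl
  time t := by
    have h0 := tauPath_even τ t 0
    have h1 := tauPath_odd τ t 0
    have h2 := tauPath_even τ (t + 1) 0
    simp only [mul_zero, zero_add] at h0 h1 h2
    rw [h0, h1, h2]
    simp only [gradT]
    ring
  space t n := by
    rw [tauPath_even, tauPath_odd]
    simp only [gradT]
    ring

theorem SolvesTauIVP.isAuxArray (h : SolvesTauIVP x y τ) (hxy : GrowthCondition x y) :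
    IsAuxArray (y 0) (fun t => iter t (initPath x y)) (gradT (logArray τ)) := by
  have h1 := isAuxArray_gradT_logArray τ
  rw [h.2.2 0] at h1
  have h2 : tauPath τ = fun t => iter t (initPath x y) := funext (h.tauPath_eq hxy)
  rwa [h2] at h1

theorem SolvesTauIVP.unique {τ' : ℤ → ℤ → ℝ} (h : SolvesTauIVP x y τ) (h' : SolvesTauIVP x y τ')
    (hxy : GrowthCondition x y) : τ' = τ := by
  have h1 := (h.isAuxArray hxy).eq (h'.isAuxArray hxy)
  funext t n
  rw [← h.1.exp_log, ← h'.1.exp_log]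
  congr 1
  refine eq_of_sub_eq (f := fun t => logArray τ' t n) (g := fun t => logArray τ t n)
    ((h'.2.1 n).trans (h.2.1 n).symm) (fun t => ?_) t
  exact congrFun (congrFun h1 t) n

/-- Both signed sums telescope: the first one to `log τ_0^{t+n}`, and the second one, along the
antidiagonal, to `log τ_0^{t+n} - log τ_n^t`. -/
theorem SolvesTauIVP.log_eq (h : SolvesTauIVP x y τ) (hxy : GrowthCondition x y) (t n : ℤ) :
    Real.log (τ t n) = x 0 + signedSum (fun s => gradT (logArray τ) s 0) 0 (t + n - 1)
      - signedSum (fun m => iter (t + m - 1) (initPath x y) (2 * (n - m))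
          - gradT (logArray τ) (t + m - 1) (n - m)) 1 n := by
  have e1 : (fun s => gradT (logArray τ) s 0) = gradSeq fun s => logArray τ (s + 1) 0 := by
    funext s
    simp [gradSeq, gradT]
  have e2 : (fun m => iter (t + m - 1) (initPath x y) (2 * (n - m))
      - gradT (logArray τ) (t + m - 1) (n - m)) = gradSeq fun m => logArray τ (t + m) (n - m) := by
    funext m
    rw [← h.tauPath_eq hxy, tauPath_even]
    simp only [gradSeq, gradT, sub_add_cancel]
    rw [show t + (m - 1) = t + m - 1 by ring, show n - (m - 1) = n - m + 1 by ring]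
    ring
  have h0 : logArray τ 0 0 = x 0 := h.2.1 0
  rw [e1, e2, signedSum_gradSeq, signedSum_gradSeq]
  simp only [sub_add_cancel, sub_self, sub_zero, add_zero, zero_sub, neg_add_cancel, h0]
  rw [show Real.log (τ t n) = logArray τ t n from rfl]
  ring

/-! ### Existence -/

theorem exists_solvesTauIVP (hxy : GrowthCondition x y) : ∃ τ, SolvesTauIVP x y τ := by
  have h0 := hxy.initPath_mem_Slin
  set S : ℤ → ℤ → ℝ := fun t => iter t (initPath x y) with hS
  have hmem : ∀ t, S t ∈ Slin := iter_mem_Slin h0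
  have hstep : ∀ t, S (t + 1) = step (S t) := iter_add_one h0
  have heven : ∀ t k, S (t + 1) (2 * k) = 2 * logSumExp (S t) k - S t (2 * k + 1) := fun t k => by
    rw [hstep, step_even]
  have hodd : ∀ t k, S (t + 1) (2 * k + 1) =
      logSumExp (S t) (k + 1) + logSumExp (S t) k - S t (2 * k + 2) := fun t k => by
    rw [hstep, step_odd]
  obtain ⟨A, hA⟩ := exists_isAuxArray (y 0) S
  -- the time equation of the auxiliary array propagates from the site `0` to all sites
  have htime : ∀ t n, A (t + 1) n - A t n = logSumExp (S t) n - S t (2 * n) := fun t n => by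
    refine eq_of_sub_eq (f := fun n => A (t + 1) n - A t n)
      (g := fun n => logSumExp (S t) n - S t (2 * n)) ?_ (fun n => ?_) n
    · have h1 := hA.time t
      have h2 := heven t 0
      simp only [mul_zero, zero_add] at h2 ⊢
      linarith
    · have h1 := hA.space t n
      have h2 := hA.space (t + 1) n
      have h3 := heven t n
      have h4 := hodd t n
      rw [show 2 * n + 2 = 2 * (n + 1) by ring] at h4
      linarith
  have hA0 : ∀ n, A 0 n = y n := by
    refine eq_of_sub_eq hA.zero fun n => ?_
    have h1 := hA.space 0 n
    simp only [hS, iter_zero, initPath_even, initPath_odd] at h1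
    linarith
  set σ : ℤ → ℤ → ℝ := fun t n => x n + signedSum (fun s => A s n) 0 (t - 1) with hσ
  have hσ0 : ∀ n, σ 0 n = x n := fun n => by
    have := signedSum_self (fun s => A s n) (-1)
    rw [neg_add_cancel] at this
    simp only [hσ, zero_sub, this, add_zero]
  have hσA : ∀ t n, σ (t + 1) n - σ t n = A t n := fun t n => by
    have := signedSum_succ (fun s => A s n) 0 (t - 1)
    rw [sub_add_cancel] at this
    simp only [hσ, add_sub_cancel_right, this]
    ring
  clear_value σ
  have hSσ : ∀ t n, S t (2 * n) = 2 * A t n - σ t (n + 1) + σ t n := fun t n => by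
    refine eq_of_sub_eq (f := fun t => S t (2 * n))
      (g := fun t => 2 * A t n - σ t (n + 1) + σ t n) ?_ (fun t => ?_) t
    · simp only [hS, iter_zero, initPath_even, hA0, hσ0]
    · have h1 := htime t n
      have h2 := heven t n
      have h3 := hA.space t n
      have h4 := hσA t n
      have h5 := hσA t (n + 1)
      linarith
  have hlog : logArray (fun t n => Real.exp (σ t n)) = σ := by
    funext t n
    exact Real.log_exp _
  refine ⟨fun t n => Real.exp (σ t n), ⟨fun t n => Real.exp_pos _, fun t n => ?_⟩,
    fun n => by rw [Real.log_exp, hσ0], fun n => ?_⟩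
  · have hL : ∀ k, expSum (S (t - 1)) k = Real.exp (σ (t + 1) k - σ (t - 1) (k + 1)) := fun k => by
      have h1 := htime (t - 1) k
      have h2 := hSσ (t - 1) k
      have h3 := hσA (t - 1) k
      have h4 := hσA t k
      rw [sub_add_cancel] at h1 h3
      rw [← Slin.exp_logSumExp (hmem _)]
      congr 1
      linarith
    have h1 := Slin.expSum_sub (hmem (t - 1)) n
    have h2 := hσA (t - 1) n
    rw [sub_add_cancel] at h2
    rw [hL, hL, hSσ, ← h2, sub_add_cancel] at h1
    rw [Real.exp_sub, Real.exp_sub, show 2 * (σ t n - σ (t - 1) n) - σ (t - 1) (n + 1) + σ (t - 1) n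
      = σ t n + σ t n - σ (t - 1) n - σ (t - 1) (n + 1) by ring, Real.exp_sub, Real.exp_sub,
      Real.exp_add] at h1
    have p1 := Real.exp_pos (σ (t - 1) n)
    have p2 := Real.exp_pos (σ (t - 1) (n + 1))
    generalize Real.exp (σ (t - 1) n) = a at *
    generalize Real.exp (σ (t - 1) (n + 1)) = b at *
    generalize Real.exp (σ (t + 1) n) = c at *
    generalize Real.exp (σ t n) = d at *
    field_simp at h1
    linarith
  · rw [hlog, gradT, hσA, hA0]

end DToda

theorem mainTheorem9 (x y : ℤ → ℝ) (hxy : GrowthCondition x y) :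
    -- the initial configuration is admissible and the iterates of the path map make sense
    (initI y, initJ x y) ∈ Cdt ∧
    (∀ S ∈ Slin, ∀ k : ℤ, Summable fun j : ℕ => Real.exp (S (2 * (k - (j : ℤ))))) ∧
    Set.BijOn step Slin Slin ∧
    (∀ t : ℤ, iter t (initPath x y) ∈ Slin) ∧
    -- existence and uniqueness of the solution of the tau-function equation
    ∃ τ : ℤ → ℤ → ℝ, SolvesTauIVP x y τ ∧ (∀ τ', SolvesTauIVP x y τ' → τ' = τ) ∧
      -- the explicit formula
      (∃ A : ℤ → ℤ → ℝ,
        IsAuxArray (y 0) (fun t => iter t (initPath x y)) A ∧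
        (∀ A', IsAuxArray (y 0) (fun t => iter t (initPath x y)) A' → A' = A) ∧
        ∀ t n : ℤ, Real.log (τ t n) =
          x 0 + signedSum (fun s => A s 0) 0 (t + n - 1)
            - signedSum (fun m => iter (t + m - 1) (initPath x y) (2 * (n - m))
                - A (t + m - 1) (n - m)) 1 n) ∧
      -- the log-differences are the unique solution of the discrete Toda equation
      (IsTodaSolution (tauI τ) (tauJ τ) (tauU τ) ∧
        tauI τ 0 = initI y ∧ tauJ τ 0 = initJ x y ∧
        (∀ I J U : ℤ → ℤ → ℝ, IsTodaSolution I J U → I 0 = initI y → J 0 = initJ x y →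
          I = tauI τ ∧ J = tauJ τ ∧ U = tauU τ) ∧
        -- its description through the path encoding
        (∀ t n : ℤ,
          tauI τ t n = Real.exp (iter t (pathEncoding (initI y) (initJ x y)) (2 * n - 1)
            - iter t (pathEncoding (initI y) (initJ x y)) (2 * n - 2)) ∧
          tauJ τ t n = Real.exp (-(iter t (pathEncoding (initI y) (initJ x y)) (2 * n)
            - iter t (pathEncoding (initI y) (initJ x y)) (2 * n - 1))) ∧
          tauU τ t n = Real.exp ((iter t (pathEncoding (initI y) (initJ x y)) (2 * n - 1)
            - iter (t + 1) (pathEncoding (initI y) (initJ x y)) (2 * n - 2)) / 2)) ∧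
        ∀ t : ℤ, (tauI τ t, tauJ τ t) ∈ Cdt) := by
  obtain ⟨τ, hτ⟩ := exists_solvesTauIVP hxy
  have hS := hxy.initPath_mem_Slin
  have hToda := hτ.1.isTodaSolution
  have hE := hxy.pathEncoding_mem_Slin
  have hI := hτ.tauI_zero
  have hJ := hτ.tauJ_zero
  have hE' : pathEncoding (tauI τ 0) (tauJ τ 0) ∈ Slin := by rwa [hI, hJ]
  refine ⟨(encodes_initPath x y).mem_Cdt hS (fun _ => Real.exp_pos _) (fun _ => Real.exp_pos _),
    fun S hS k => Slin.summable hS k, bijOn_step, iter_mem_Slin hS, τ, hτ,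
    fun τ' hτ' => hτ.unique hτ' hxy,
    ⟨gradT (logArray τ), hτ.isAuxArray hxy, fun A' hA' => (hτ.isAuxArray hxy).eq hA',
      hτ.log_eq hxy⟩,
    hToda, hI, hJ, fun I J U h h1 h2 => ?_, fun t n => ?_, hToda.mem_Cdt hE'⟩
  · have h0 : pathEncoding (I 0) (J 0) ∈ Slin := by rwa [h1, h2]
    refine ⟨?_, ?_, ?_⟩ <;> funext t n
    · rw [h.I_eq h0, hToda.I_eq hE', h1, h2, hI, hJ]
    · rw [h.J_eq h0, hToda.J_eq hE', h1, h2, hI, hJ]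
    · rw [h.U_eq h0, hToda.U_eq hE', h1, h2, hI, hJ]
  · have a1 := hToda.I_eq hE' t n
    have a2 := hToda.J_eq hE' t n
    have a3 := hToda.U_eq hE' t n
    rw [hI, hJ] at a1 a2 a3
    exact ⟨a1, a2, a3⟩
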